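/- Let $M$ be a metric space with a designated origin $0\in M$, and let $X$ be a real Banach space. Let $Lip(M,X^*)$ be the space of all Lipschitz functions $f:M\to X^*$ with $f(0)=0$, under the norm $\|f\|=\sup\{\|f(x)-f(y)\|/d(x,y): x,y\in M,\ x\neq y\}$ (with $\sup\emptyset=0$). For $m\in M$ and $x\in X$ let $\delta_{m,x}\in Lip(M,X^*)^*$ be given by $\delta_{m,x}(f)=f(m)(x)$, and let $\mathcal F(M,X)$ be the closed linear span of $\{\delta_{m,x}: m\in M,\ x\in X\}$ in $Lip(M,X^*)^*$. A slice of the closed unit ball $B_E$ of a real Banach space $E$ is a set $S(B_E,f,\alpha)=\{e\in B_E: f(e)>1-\alpha\}$ with $f\in E^*$, $\|f\|=1$ and $\alpha>0$. The space $E$ has the strong diameter two property if every convex combination of slices of $B_E$, that is, every set $\sum_{i=1}^n\lambda_i S(B_E,f_i,\alpha_i)$ with $n\ge 1$, $\lambda_i\in(0,1]$ and $\sum_{i=1}^n\lambda_i=1$, has diameter two. The space $M$ is metrically convex if for all $x,y\in M$ and all $r,s\geq 0$ with $r+s=d(x,y)$ there is $z\in M$ with $d(x,z)=r$ and $d(z,y)=s$.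 If $M$ is metrically convex and $X$ has the strong diameter two property, then $\mathcal F(M,X)$ has the strong diameter two property. -/

import Mathlib

open scoped NNReal

noncomputable section

/-! ## Lipschitz functions vanishing at the base point -/

/-- The linear space of all Lipschitz functions `M → Y` that vanish at the base point `o`. -/
def lipSubmodule {M : Type*} [MetricSpace M] (o : M) (Y : Type*) [NormedAddCommGroup Y]
    [NormedSpace ℝ Y] : Submodule ℝ (M → Y) where
  carrier := {f | f o = 0 ∧ ∃ K : ℝ≥0, LipschitzWith K f}
  zero_mem' := ⟨rfl, 0, LipschitzWith.const (0 : Y)⟩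
  add_mem' := by
    rintro f g ⟨hf, K, hK⟩ ⟨hg, L, hL⟩
    exact ⟨by simp [hf, hg], K + L, hK.add hL⟩
  smul_mem' := by
    rintro c f ⟨hf, K, hK⟩
    exact ⟨by simp [hf], ‖c‖₊ * K, (lipschitzWith_smul c).comp hK⟩

/-- `Lip(M, Y)`: the Lipschitz functions `M → Y` vanishing at the base point `o`, as a type of its
own, so that it carries the Lipschitz norm and not the topology of pointwise convergence. -/
def Lip {M : Type*} [MetricSpace M] (o : M) (Y : Type*) [NormedAddCommGroup Y]
    [NormedSpace ℝ Y] : Type _ :=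
  ↥(lipSubmodule o Y)

namespace Lip

variable {M : Type*} [MetricSpace M] {o : M} {Y : Type*} [NormedAddCommGroup Y] [NormedSpace ℝ Y]

instance : AddCommGroup (Lip o Y) := inferInstanceAs (AddCommGroup ↥(lipSubmodule o Y))

instance : Module ℝ (Lip o Y) := inferInstanceAs (Module ℝ ↥(lipSubmodule o Y))

instance : CoeFun (Lip o Y) (fun _ => M → Y) := ⟨fun f => f.1⟩

theorem ext {f g : Lip o Y} (h : ∀ m, f m = g m) : f = g := Subtype.ext (funext h)

@[simp] theorem zero_apply (m : M) : (0 : Lip o Y) m = 0 := rfl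
@[simp] theorem add_apply (f g : Lip o Y) (m : M) : (f + g) m = f m + g m := rfl
@[simp] theorem smul_apply (c : ℝ) (f : Lip o Y) (m : M) : (c • f) m = c • f m := rfl
@[simp] theorem base_apply (f : Lip o Y) : f o = 0 := f.2.1

/-- The set of all slopes `‖f x - f y‖ / d(x, y)`, `x ≠ y`. -/
def slopes (f : Lip o Y) : Set ℝ := {r | ∃ x y : M, x ≠ y ∧ r = ‖f x - f y‖ / dist x y}

/-- The Lipschitz norm: the supremum of the slopes (it is `0` if `M` has just one point). -/
instance : Norm (Lip o Y) := ⟨fun f => sSup f.slopes⟩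

theorem norm_def (f : Lip o Y) : ‖f‖ = sSup f.slopes := rfl

theorem bddAbove_slopes (f : Lip o Y) : BddAbove f.slopes := by
  obtain ⟨K, hK⟩ := f.2.2
  refine ⟨K, ?_⟩
  rintro r ⟨x, y, hxy, rfl⟩
  rw [div_le_iff₀ (dist_pos.2 hxy), ← dist_eq_norm]
  exact hK.dist_le_mul x y

theorem lip_norm_nonneg (f : Lip o Y) : 0 ≤ ‖f‖ := by
  apply Real.sSup_nonneg
  rintro r ⟨x, y, -, rfl⟩
  positivity

theorem norm_apply_sub_le (f : Lip o Y) (x y : M) : ‖f x - f y‖ ≤ ‖f‖ * dist x y := by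
  by_cases hxy : x = y
  · simp [hxy]
  · rw [← div_le_iff₀ (dist_pos.2 hxy)]
    exact le_csSup f.bddAbove_slopes ⟨x, y, hxy, rfl⟩

theorem norm_apply_le (f : Lip o Y) (m : M) : ‖f m‖ ≤ ‖f‖ * dist m o := by
  simpa using f.norm_apply_sub_le m o

theorem norm_le_of_forall (f : Lip o Y) {C : ℝ} (hC : 0 ≤ C)
    (h : ∀ x y, ‖f x - f y‖ ≤ C * dist x y) : ‖f‖ ≤ C := by
  apply Real.sSup_le _ hC
  rintro r ⟨x, y, hxy, rfl⟩
  rw [div_le_iff₀ (dist_pos.2 hxy)]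
  exact h x y

theorem norm_smul_le' (c : ℝ) (f : Lip o Y) : ‖c • f‖ ≤ ‖c‖ * ‖f‖ := by
  refine norm_le_of_forall _ (mul_nonneg (norm_nonneg _) f.lip_norm_nonneg) fun x y => ?_
  rw [smul_apply, smul_apply, ← smul_sub, norm_smul, mul_assoc]
  exact mul_le_mul_of_nonneg_left (f.norm_apply_sub_le x y) (norm_nonneg _)

theorem normedSpaceCore : NormedSpace.Core ℝ (Lip o Y) where
  norm_nonneg := lip_norm_nonneg
  norm_smul c f := by
    refine le_antisymm (norm_smul_le' c f) ?_
    by_cases hc : c = 0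
    · subst hc
      simpa using lip_norm_nonneg ((0 : ℝ) • f)
    · have h := norm_smul_le' c⁻¹ (c • f)
      rw [smul_smul, inv_mul_cancel₀ hc, one_smul, norm_inv] at h
      rwa [← div_eq_inv_mul, le_div_iff₀ (norm_pos_iff.2 hc), mul_comm] at h
  norm_triangle f g := by
    refine norm_le_of_forall _ (add_nonneg f.lip_norm_nonneg g.lip_norm_nonneg) fun x y => ?_
    have h : (f + g) x - (f + g) y = (f x - f y) + (g x - g y) := by
      simp only [add_apply]; abel
    rw [h, add_mul]
    exact (norm_add_le _ _).trans (add_le_add (f.norm_apply_sub_le x y) (g.norm_apply_sub_le x y))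
  norm_eq_zero_iff f := by
    constructor
    · intro h
      refine ext fun m => ?_
      have := f.norm_apply_le m
      rw [h, zero_mul] at this
      simpa using this
    · rintro rfl
      exact le_antisymm (norm_le_of_forall _ le_rfl (by simp)) (lip_norm_nonneg _)

instance : NormedAddCommGroup (Lip o Y) := NormedAddCommGroup.ofCore normedSpaceCore

instance : NormedSpace ℝ (Lip o Y) := NormedSpace.ofCore normedSpaceCore

end Lip

/-! ## The vector-valued Lipschitz-free space -/

/-- The evaluation functional `δ_{m,x} : Lip(M, X*) → ℝ`, `f ↦ f(m)(x)`. -/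
def lipDelta {M : Type*} [MetricSpace M] (o : M) {X : Type*} [NormedAddCommGroup X]
    [NormedSpace ℝ X] (m : M) (x : X) : StrongDual ℝ (Lip o (StrongDual ℝ X)) :=
  LinearMap.mkContinuous
    { toFun := fun f => f m x
      map_add' := fun _ _ => rfl
      map_smul' := fun _ _ => rfl }
    (dist m o * ‖x‖)
    (fun f => by
      refine ((f m).le_opNorm x).trans ?_
      refine (mul_le_mul_of_nonneg_right (f.norm_apply_le m) (norm_nonneg x)).trans_eq ?_
      ring)

@[simp] theorem lipDelta_apply {M : Type*} [MetricSpace M] (o : M) {X : Type*}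
    [NormedAddCommGroup X] [NormedSpace ℝ X] (m : M) (x : X) (f : Lip o (StrongDual ℝ X)) :
    lipDelta o m x f = f m x := rfl

/-- The vector-valued Lipschitz-free space `F(M, X)`: the closed linear span of the functionals
`δ_{m,x}`, `m ∈ M`, `x ∈ X`, in the dual of `Lip(M, X*)`, with the norm of that dual. -/
def lipFree {M : Type*} [MetricSpace M] (o : M) (X : Type*) [NormedAddCommGroup X]
    [NormedSpace ℝ X] : Submodule ℝ (StrongDual ℝ (Lip o (StrongDual ℝ X))) :=
  (Submodule.span ℝ {φ | ∃ (m : M) (x : X), φ = lipDelta o m x}).topologicalClosure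

/-! ## The strong diameter two property and metric convexity -/

/-- The slice `{x ∈ B_X : f x > 1 - α}` of the closed unit ball of `X`. -/
def ballSlice {X : Type*} [NormedAddCommGroup X] [NormedSpace ℝ X] (f : StrongDual ℝ X) (α : ℝ) :
    Set X :=
  {x | ‖x‖ ≤ 1 ∧ 1 - α < f x}

/-- The strong diameter two property: every convex combination
`∑ i, c i • S(B_X, f i, α i)` of slices of the closed unit ball has diameter two. -/
def StrongDiameterTwoProperty (X : Type*) [NormedAddCommGroup X] [NormedSpace ℝ X] : Prop :=
  ∀ (n : ℕ) (f : Fin n → StrongDual ℝ X) (α c : Fin n → ℝ),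
    (∀ i, ‖f i‖ = 1) → (∀ i, 0 < α i) → (∀ i, 0 < c i) → ∑ i, c i = 1 →
      Metric.diam {z : X | ∃ x : Fin n → X, (∀ i, x i ∈ ballSlice (f i) (α i)) ∧
        z = ∑ i, c i • x i} = 2

/-- A metric space is metrically convex if for all points `x`, `y` and all `r, s ≥ 0` with
`r + s = d(x, y)` some point lies at distance `r` from `x` and at distance `s` from `y`. -/
def MetricallyConvex (M : Type*) [MetricSpace M] : Prop :=
  ∀ (x y : M) (r s : ℝ), 0 ≤ r → 0 ≤ s → r + s = dist x y →
    ∃ z : M, dist x z = r ∧ dist z y = s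

end

/-! The dual of `F(M, X)` is `Lip(M, X*)`, so every slice of the unit ball of `F(M, X)` contains an
elementary molecule `(δ_{p,x} - δ_{q,x}) / d(p, q)` with `‖x‖ ≤ 1`: choose `p`, `q` where the
Lipschitz function `h` that represents the functional is steep
(`LipFreeSpace.exists_lip_representing_steep`), and then any `x` in a certain slice of `B_X`. With
the pairs `(pᵢ, qᵢ)` of `n` given slices fixed, the strong diameter two property of `X` yields such
vectors `xᵢ`, `yᵢ` and a functional `x*` in the dual unit ball for which `x* (∑ cᵢ (xᵢ - yᵢ))` is
almost `2`.

Now fix the vectors and change the pairs instead. Each of the `2n` real functions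
`m ↦ hᵢ m xᵢ`, `m ↦ hᵢ m yᵢ` is steep on some pair of points, hence, by repeated bisection in the
metrically convex space `M`, on pairs of points arbitrarily close to each other
(`MetricallyConvex.exists_steep_pair_dist_lt`). A real function with Lipschitz constant below `1`
can be altered to be steep on a new pair, without changing its values on a finite set and at
an arbitrarily small cost in the Lipschitz constant, once the points of the pair are close enough
(`exists_lipschitz_steep_on_close_pair`). Hence one `1`-Lipschitz function `g` is almost as steep
as possible on steep pairs for all `2n` functions at once (`exists_lipschitz_steep_on_pairs`). The
tensor `m ↦ g m • x*` lies in the unit ball of `Lip(M, X*)`, and evaluating it at the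
difference of the two convex combinations of molecules shows that they are almost `2` apart. -/

/-! ### Steep pairs of points in metric spaces -/

/-- In a metrically convex space, a real function with a slope above `c` has such slopes at
arbitrarily small scales: one of the two halves of a pair is at least as steep as the pair. -/
theorem MetricallyConvex.exists_steep_pair_dist_lt {M : Type*} [MetricSpace M]
    (hM : MetricallyConvex M) (h : M → ℝ) {c : ℝ} {p q : M} (hpq : p ≠ q)
    (hs : c * dist p q < h p - h q) {ρ : ℝ} (hρ : 0 < ρ) :
    ∃ p' q' : M, p' ≠ q' ∧ dist p' q' < ρ ∧ c * dist p' q' < h p' - h q' := by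
  have key : ∀ n : ℕ, ∃ p' q' : M, dist p' q' = dist p q * (1 / 2) ^ n ∧
      c * dist p' q' < h p' - h q' := by
    intro n
    induction n with
    | zero => exact ⟨p, q, by simp, hs⟩
    | succ n ih =>
      obtain ⟨a, b, hab, hsl⟩ := ih
      obtain ⟨z, haz, hzb⟩ := hM a b (dist a b / 2) (dist a b / 2) (by positivity) (by positivity)
        (by ring)
      rcases lt_or_ge (c * dist a z) (h a - h z) with h1 | h1
      · exact ⟨a, z, by rw [haz, hab, pow_succ]; ring, h1⟩
      · refine ⟨z, b, by rw [hzb, hab, pow_succ]; ring, ?_⟩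
        rw [haz] at h1
        rw [hzb]
        linarith
  have hd : 0 < dist p q := dist_pos.2 hpq
  obtain ⟨n, hn⟩ := exists_pow_lt_of_lt_one (div_pos hρ hd) (by norm_num : (1 / 2 : ℝ) < 1)
  obtain ⟨a, b, hab, hsl⟩ := key n
  refine ⟨a, b, dist_pos.1 (by rw [hab]; positivity), ?_, hsl⟩
  rw [hab, mul_comm]
  exact (lt_div_iff₀ hd).1 hn

/-- A `K`-Lipschitz function can be prescribed to have slope `K` on any pair of sufficiently close
points without changing its values on the finite set `F`, at the cost of a Lipschitz constant
`L > K`. -/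
theorem exists_lipschitz_steep_on_close_pair {M : Type*} [MetricSpace M] {K L : ℝ≥0} (hKL : K < L)
    {g : M → ℝ} (hg : LipschitzWith K g) (F : Finset M) :
    ∃ ρ > 0, ∀ p q : M, dist p q < ρ → ∃ g' : M → ℝ, LipschitzWith L g' ∧
      (∀ x ∈ F, g' x = g x) ∧ g' p - g' q = K * dist p q := by
  classical
  have hKL' : (K : ℝ) < L := hKL
  have hK0 : (0 : ℝ) ≤ K := K.2
  have hg' : ∀ x y, |g x - g y| ≤ K * dist x y := fun x y => by
    simpa [Real.dist_eq] using hg.dist_le_mul x y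
  -- `w` serves as an anchor near the pair at which the new function keeps the value of `g`.
  have glue : ∀ p q w : M,
      (∀ x ∈ F, x ≠ w → ∀ y, y = p ∨ y = q → 2 * K * dist y w ≤ (L - K) * dist y x) →
      ∃ g' : M → ℝ, LipschitzWith L g' ∧
        (∀ x ∈ F, g' x = g x) ∧ g' p - g' q = K * dist p q := by
    intro p q w hw
    set ψ : M → ℝ := fun y => g w + K * (dist y q - dist w q) with hψ
    have hψl : ∀ x y, |ψ x - ψ y| ≤ K * dist x y := by
      intro x y
      have : ψ x - ψ y = K * (dist x q - dist y q) := by simp only [hψ]; ring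
      rw [this, abs_mul, abs_of_nonneg hK0]
      exact mul_le_mul_of_nonneg_left (abs_dist_sub_le x y q) hK0
    have hψw : ψ w = g w := by simp [hψ]
    have cross : ∀ x ∈ F, ∀ y, y = p ∨ y = q → |ψ y - g x| ≤ L * dist y x := by
      intro x hx y hy
      by_cases hxw : x = w
      · subst hxw
        rw [← hψw]
        exact (hψl y x).trans (mul_le_mul_of_nonneg_right hKL'.le dist_nonneg)
      · have h1 := hw x hx hxw y hy
        have h2 := hψl y w
        have h3 := hg' w x
        have h4 : |ψ y - g x| ≤ |ψ y - ψ w| + |g w - g x| := by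
          rw [hψw]; exact abs_sub_le _ _ _
        have h5 : dist w x ≤ dist y w + dist y x := by
          rw [dist_comm y w]; exact dist_triangle _ _ _
        have h6 := mul_le_mul_of_nonneg_left h5 hK0
        linarith
    set φ : M → ℝ := fun y => if y ∈ F then g y else ψ y with hφ
    set S : Set M := {y | y ∈ F ∨ y = p ∨ y = q} with hS
    have hgL : ∀ x y, |g x - g y| ≤ L * dist x y := fun x y =>
      (hg' x y).trans (mul_le_mul_of_nonneg_right hKL'.le dist_nonneg)
    have hψL : ∀ x y, |ψ x - ψ y| ≤ L * dist x y := fun x y =>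
      (hψl x y).trans (mul_le_mul_of_nonneg_right hKL'.le dist_nonneg)
    have hpqF : ∀ x ∈ F, x = p ∨ x = q → ψ x = g x := fun x hx hxpq => by
      have h := cross x hx x hxpq
      rw [dist_self, mul_zero] at h
      exact sub_eq_zero.1 (abs_nonpos_iff.1 h)
    have hφF : ∀ x ∈ F, φ x = g x := fun x hx => if_pos hx
    have hφψ : ∀ x, x = p ∨ x = q → φ x = ψ x := fun x hx => by
      by_cases hxF : x ∈ F
      · rw [hφF x hxF, hpqF x hxF hx]
      · exact if_neg hxF
    have hφL : LipschitzOnWith L φ S := by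
      refine LipschitzOnWith.of_dist_le_mul fun x hx y hy => ?_
      rw [Real.dist_eq]
      rcases hx with hx | hx <;> rcases hy with hy | hy
      · rw [hφF x hx, hφF y hy]; exact hgL x y
      · rw [hφF x hx, hφψ y hy, abs_sub_comm, dist_comm]; exact cross x hx y hy
      · rw [hφψ x hx, hφF y hy]; exact cross y hy x hx
      · rw [hφψ x hx, hφψ y hy]; exact hψL x y
    obtain ⟨g', hg'L, hEq⟩ := hφL.extend_real
    refine ⟨g', hg'L, fun x hx => by rw [← hEq (Or.inl hx), hφF x hx], ?_⟩
    rw [← hEq (Or.inr (Or.inl rfl)), ← hEq (Or.inr (Or.inr rfl)), hφψ p (Or.inl rfl),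
      hφψ q (Or.inr rfl)]
    simp only [hψ, dist_self]
    ring
  obtain ⟨σ, hσ, hsep⟩ : ∃ σ > 0, ∀ x ∈ F, ∀ z ∈ F, x ≠ z → σ ≤ dist x z := by
    rcases (F : Set M).subsingleton_or_nontrivial with hF | hF
    · exact ⟨1, one_pos, fun x hx z hz hxz => (hxz (hF hx hz)).elim⟩
    · exact ⟨(F : Set M).infsep, Set.infsep_pos_iff_nontrivial_of_finite.2 hF,
        fun x hx z hz hxz => Set.infsep_le_dist_of_mem hx hz hxz⟩
  set ε : ℝ := L - K with hε
  have hε0 : 0 < ε := sub_pos.2 hKL'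
  have hD : 0 < 2 * K + ε := by positivity
  set θ : ℝ := ε / (2 * K + ε) with hθ
  have hθ0 : 0 < θ := div_pos hε0 hD
  have hθD : (2 * K + ε) * θ = ε := by rw [hθ]; field_simp
  have hθ1 : θ ≤ 1 := (div_le_one hD).2 (by linarith)
  set δ : ℝ := θ * σ / 2 with hδ
  have hδ0 : 0 < δ := by positivity
  refine ⟨θ * δ, by positivity, fun p q hpq => ?_⟩
  by_cases hq : ∃ z ∈ F, dist q z < δ
  · -- Near a point of `F` that point is the anchor, and all other points of `F` are far away.
    obtain ⟨w, hwF, hqw⟩ := hq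
    refine glue p q w fun x hx hxw y hy => ?_
    have h1 := hsep x hx w hwF hxw
    have h2 : dist y w ≤ 2 * δ := by
      have h3 : θ * δ ≤ δ := mul_le_of_le_one_left hδ0.le hθ1
      rcases hy with rfl | rfl
      · linarith [dist_triangle y q w]
      · linarith
    have h3 : dist x w ≤ dist y x + dist y w := by
      rw [dist_comm y x]; exact dist_triangle _ _ _
    have h4 : (2 * K + ε) * dist y w ≤ ε * σ := by
      calc (2 * K + ε) * dist y w ≤ (2 * K + ε) * (2 * δ) := by gcongr
        _ = ((2 * K + ε) * θ) * σ := by rw [hδ]; ring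
        _ = ε * σ := by rw [hθD]
    have h5 : ε * σ ≤ ε * (dist y x + dist y w) := by gcongr; linarith
    linarith
  · -- Away from `F` the pair itself supplies the anchor.
    push Not at hq
    refine glue p q q fun x hx _ y hy => ?_
    have h1 := hq x hx
    have h2 : dist y q ≤ θ * δ := by
      rcases hy with rfl | rfl
      · exact hpq.le
      · rw [dist_self]; positivity
    have h3 : dist q x ≤ dist y x + dist y q := by
      rw [add_comm, dist_comm y q]; exact dist_triangle _ _ _
    have h4 : (2 * K + ε) * dist y q ≤ ε * δ := by
      calc (2 * K + ε) * dist y q ≤ (2 * K + ε) * (θ * δ) := by gcongr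
        _ = ((2 * K + ε) * θ) * δ := by ring
        _ = ε * δ := by rw [hθD]
    have h5 : ε * δ ≤ ε * (dist y x + dist y q) := by gcongr; linarith
    linarith

/-- If each of finitely many relations on `M` holds for pairs of points at arbitrarily small
distances, then one `1`-Lipschitz function has slope at least `c < 1` on a suitable pair for each
of the relations. -/
theorem exists_lipschitz_steep_on_pairs {M : Type*} [MetricSpace M] {ι : Type*} [Finite ι]
    (P : ι → M → M → Prop)
    (hP : ∀ i, ∀ ρ > 0, ∃ p q : M, p ≠ q ∧ dist p q < ρ ∧ P i p q) {c : ℝ≥0} (hc : c < 1) :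
    ∃ (p q : ι → M) (g : M → ℝ), LipschitzWith 1 g ∧
      ∀ i, p i ≠ q i ∧ P i (p i) (q i) ∧ c * dist (p i) (q i) ≤ g (p i) - g (q i) := by
  classical
  cases nonempty_fintype ι
  -- The Lipschitz constant stays strictly below `1` to leave room for the pairs still to come.
  have key : ∀ s : Finset ι, ∃ (p q : ι → M) (K : ℝ≥0) (g : M → ℝ), K < 1 ∧ LipschitzWith K g ∧
      ∀ i ∈ s, p i ≠ q i ∧ P i (p i) (q i) ∧ c * dist (p i) (q i) ≤ g (p i) - g (q i) := by
    intro s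
    induction s using Finset.induction_on with
    | empty =>
      choose p q _ using fun i => hP i 1 one_pos
      exact ⟨p, q, 0, fun _ => 0, zero_lt_one, LipschitzWith.const 0, by simp⟩
    | insert j s hj ih =>
      obtain ⟨p, q, K, g, hK, hg, hs⟩ := ih
      obtain ⟨L, hKL, hL⟩ := exists_between (max_lt hK hc)
      obtain ⟨ρ, hρ, H⟩ := exists_lipschitz_steep_on_close_pair hKL
        (hg.weaken (le_max_left K c)) (s.image p ∪ s.image q)
      obtain ⟨a, b, hab, habρ, hPab⟩ := hP j ρ hρ
      obtain ⟨g', hg', hgF, hgab⟩ := H a b habρ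
      refine ⟨Function.update p j a, Function.update q j b, L, g', hL, hg', fun i hi => ?_⟩
      by_cases hij : i = j
      · subst hij
        simp only [Function.update_self]
        refine ⟨hab, hPab, ?_⟩
        rw [hgab]
        gcongr
        exact le_max_right K c
      · have his : i ∈ s := (Finset.mem_insert.1 hi).resolve_left hij
        simp only [Function.update_of_ne hij]
        rw [hgF (p i) (Finset.mem_union_left _ (Finset.mem_image_of_mem p his)),
          hgF (q i) (Finset.mem_union_right _ (Finset.mem_image_of_mem q his))]
        exact hs i his
  obtain ⟨p, q, K, g, hK, hg, h⟩ := key Finset.univ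
  exact ⟨p, q, g, hg.weaken hK.le, fun i => h i (Finset.mem_univ i)⟩

/-! ### Functionals on the vector-valued Lipschitz-free space -/

theorem lipDelta_mem_lipFree {M : Type*} [MetricSpace M] (o : M) {X : Type*}
    [NormedAddCommGroup X] [NormedSpace ℝ X] (m : M) (x : X) : lipDelta o m x ∈ lipFree o X :=
  Submodule.le_topologicalClosure _ (Submodule.subset_span ⟨m, x, rfl⟩)

/-- The space `F(M, X)` as a type, with the norm that it carries as a subspace of `Lip(M, X*)*`.
The synonym of `lipFree o X` confines instance search to this one normed space structure; the
inclusion in `Lip(M, X*)*` is `LipFreeSpace.toDual`. -/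
def LipFreeSpace {M : Type*} [MetricSpace M] (o : M) (X : Type*) [NormedAddCommGroup X]
    [NormedSpace ℝ X] : Type _ :=
  ↥(lipFree o X)

namespace LipFreeSpace

variable {M : Type*} [MetricSpace M] {o : M} {X : Type*} [NormedAddCommGroup X] [NormedSpace ℝ X]

noncomputable instance : NormedAddCommGroup (LipFreeSpace o X) :=
  inferInstanceAs (NormedAddCommGroup ↥(lipFree o X))

noncomputable instance : NormedSpace ℝ (LipFreeSpace o X) :=
  inferInstanceAs (NormedSpace ℝ ↥(lipFree o X))

/-- The isometric inclusion of `F(M, X)` in the dual of `Lip(M, X*)`. -/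
noncomputable def toDual : LipFreeSpace o X →ₗᵢ[ℝ] StrongDual ℝ (Lip o (StrongDual ℝ X)) where
  toFun u := u.1
  map_add' _ _ := rfl
  map_smul' _ _ := rfl
  norm_map' _ := rfl

/-- The evaluation `δ_{m,x}` as an element of `F(M, X)`. -/
noncomputable def delta (o : M) (m : M) (x : X) : LipFreeSpace o X :=
  ⟨lipDelta o m x, lipDelta_mem_lipFree o m x⟩

theorem toDual_delta_apply (m : M) (x : X) (f : Lip o (StrongDual ℝ X)) :
    toDual (delta o m x) f = f m x := rfl

theorem ext {u v : LipFreeSpace o X} (h : ∀ f, toDual u f = toDual v f) : u = v :=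
  toDual.injective (ContinuousLinearMap.ext h)

theorem delta_base (x : X) : delta o o x = 0 :=
  ext fun f => by simp [toDual_delta_apply]

theorem delta_add (m : M) (x y : X) : delta o m (x + y) = delta o m x + delta o m y :=
  ext fun f => by simp [toDual_delta_apply]

theorem delta_smul (m : M) (c : ℝ) (x : X) : delta o m (c • x) = c • delta o m x :=
  ext fun f => by simp [toDual_delta_apply]

theorem norm_delta_sub_le (p q : M) (x : X) :
    ‖delta o p x - delta o q x‖ ≤ dist p q * ‖x‖ := by
  rw [← toDual.norm_map]
  refine ContinuousLinearMap.opNorm_le_bound _ (by positivity) fun f => ?_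
  rw [map_sub, sub_apply, toDual_delta_apply, toDual_delta_apply]
  have h : ‖f p x - f q x‖ ≤ ‖f‖ * dist p q * ‖x‖ :=
    ((f p - f q).le_opNorm x).trans
      (mul_le_mul_of_nonneg_right (f.norm_apply_sub_le p q) (norm_nonneg x))
  linarith

theorem closure_span_delta :
    closure (Submodule.span ℝ (Set.range fun a : M × X => delta o a.1 a.2) :
      Set (LipFreeSpace o X)) = Set.univ := by
  rw [toDual.isometry.isUniformInducing.isInducing.closure_eq_preimage_closure_image,
    Set.eq_univ_iff_forall]
  intro u
  have himg : (toDual : LipFreeSpace o X → _) ''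
      (Submodule.span ℝ (Set.range fun a : M × X => delta o a.1 a.2) : Set (LipFreeSpace o X)) =
      (Submodule.span ℝ {φ | ∃ (m : M) (x : X), φ = lipDelta o m x} :
        Submodule ℝ (StrongDual ℝ (Lip o (StrongDual ℝ X)))) := by
    have h := Submodule.map_span (toDual (o := o) (X := X)).toLinearMap
      (Set.range fun a : M × X => delta o a.1 a.2)
    have e : (toDual (o := o) (X := X)).toLinearMap '' (Set.range fun a : M × X => delta o a.1 a.2)
        = {φ | ∃ (m : M) (x : X), φ = lipDelta o m x} := by
      ext φ
      constructor
      · rintro ⟨_, ⟨a, rfl⟩, rfl⟩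
        exact ⟨a.1, a.2, rfl⟩
      · rintro ⟨m, x, rfl⟩
        exact ⟨_, ⟨(m, x), rfl⟩, rfl⟩
    rw [e] at h
    rw [← h]
    rfl
  rw [Set.mem_preimage, himg]
  exact u.2

/-- The elementary molecule `(δ_{p,x} - δ_{q,x}) / d(p, q)` of `F(M, X)`; it is `0` if `p = q`. -/
noncomputable def molecule (o p q : M) (x : X) : LipFreeSpace o X :=
  (dist p q)⁻¹ • (delta o p x - delta o q x)

theorem toDual_molecule_apply (p q : M) (x : X) (f : Lip o (StrongDual ℝ X)) :
    toDual (molecule o p q x) f = (dist p q)⁻¹ * (f p x - f q x) := by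
  simp [molecule, toDual_delta_apply]

theorem norm_molecule_le (p q : M) (x : X) : ‖molecule o p q x‖ ≤ ‖x‖ := by
  rw [molecule, norm_smul, norm_inv, Real.norm_of_nonneg dist_nonneg]
  rcases eq_or_ne p q with rfl | hpq
  · simp
  · rw [inv_mul_le_iff₀ (dist_pos.2 hpq)]
    exact norm_delta_sub_le p q x

/-- Every functional on `F(M, X)` is evaluation at an element of `Lip(M, X*)`. -/
theorem exists_lip_representing (φ : StrongDual ℝ (LipFreeSpace o X)) :
    ∃ h : Lip o (StrongDual ℝ X), ∀ u, φ u = toDual u h := by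
  have hφ : ∀ p q x, ‖φ (delta o p x) - φ (delta o q x)‖ ≤ ‖φ‖ * dist p q * ‖x‖ := by
    intro p q x
    rw [← map_sub, mul_assoc]
    exact (φ.le_opNorm _).trans
      (mul_le_mul_of_nonneg_left (norm_delta_sub_le p q x) (norm_nonneg φ))
  let η : M → StrongDual ℝ X := fun m => LinearMap.mkContinuous
    { toFun := fun x => φ (delta o m x)
      map_add' := fun x y => by rw [delta_add, map_add]
      map_smul' := fun c x => by rw [delta_smul, map_smul, RingHom.id_apply] }
    (‖φ‖ * dist m o) (fun x => by simpa [delta_base] using hφ m o x)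
  have hη : ∀ m x, η m x = φ (delta o m x) := fun m x => rfl
  have hη_lip : LipschitzWith ‖φ‖₊ η := by
    refine LipschitzWith.of_dist_le_mul fun p q => ?_
    rw [dist_eq_norm]
    exact ContinuousLinearMap.opNorm_le_bound _ (by positivity) fun x => hφ p q x
  let h : Lip o (StrongDual ℝ X) :=
    ⟨η, ContinuousLinearMap.ext fun x => by rw [hη, delta_base, map_zero]; rfl, _, hη_lip⟩
  refine ⟨h, fun u => ?_⟩
  have hcl : IsClosed {u : LipFreeSpace o X | φ u = toDual u h} :=
    isClosed_eq φ.continuous ((continuous_eval_const h).comp toDual.continuous)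
  have hspan : (Submodule.span ℝ (Set.range fun a : M × X => delta o a.1 a.2) :
      Set (LipFreeSpace o X)) ⊆ {u | φ u = toDual u h} := by
    intro v hv
    induction hv using Submodule.span_induction with
    | mem v hv =>
      obtain ⟨a, rfl⟩ := hv
      exact (hη a.1 a.2).symm
    | zero => simp
    | add v w _ _ hv hw =>
      simp only [Set.mem_ofPred_eq] at hv hw ⊢
      rw [map_add, map_add, hv, hw, add_apply]
    | smul c v _ hv =>
      simp only [Set.mem_ofPred_eq] at hv ⊢
      rw [map_smul, map_smul, hv, smul_apply]
  have hu : u ∈ closure (Submodule.span ℝ (Set.range fun a : M × X => delta o a.1 a.2) :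
      Set (LipFreeSpace o X)) := by
    rw [closure_span_delta]
    exact Set.mem_univ u
  exact closure_minimal hspan hcl hu

/-- A norm-one functional on `F(M, X)` is represented by a function in `Lip(M, X*)` having slopes
arbitrarily close to `1`. -/
theorem exists_lip_representing_steep {φ : StrongDual ℝ (LipFreeSpace o X)} (hφ : ‖φ‖ = 1) :
    ∃ h : Lip o (StrongDual ℝ X),
      (∀ u, φ u = toDual u h) ∧
      ∀ t : ℝ, 0 ≤ t → t < 1 → ∃ p q : M, p ≠ q ∧ t * dist p q < ‖h p - h q‖ := by
  obtain ⟨h, hh⟩ := exists_lip_representing φ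
  refine ⟨h, hh, fun t ht0 ht1 => ?_⟩
  by_contra! H
  have h1 : ‖h‖ ≤ t := h.norm_le_of_forall ht0 fun p q => by
    rcases eq_or_ne p q with rfl | hpq
    · simp
    · exact H p q hpq
  have h2 : ‖φ‖ ≤ t := φ.opNorm_le_bound ht0 fun u => by
    rw [hh u, mul_comm, ← toDual.norm_map u]
    exact (ContinuousLinearMap.le_opNorm _ h).trans
      (mul_le_mul_of_nonneg_left h1 (norm_nonneg _))
  linarith

end LipFreeSpace

/-- The tensor `m ↦ (g m - g o) • ξ` of a `1`-Lipschitz function and a functional in the dual unit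
ball lies in the unit ball of `Lip(M, X*)`. -/
theorem exists_lip_tensor {M : Type*} [MetricSpace M] {o : M} {X : Type*}
    [NormedAddCommGroup X] [NormedSpace ℝ X] {g : M → ℝ} (hg : LipschitzWith 1 g)
    {ξ : StrongDual ℝ X} (hξ : ‖ξ‖ ≤ 1) :
    ∃ G : Lip o (StrongDual ℝ X), ‖G‖ ≤ 1 ∧ ∀ m, G m = (g m - g o) • ξ := by
  have hG : LipschitzWith 1 fun m => (g m - g o) • ξ := by
    refine LipschitzWith.of_dist_le_mul fun x y => ?_
    have h := hg.dist_le_mul x y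
    have e : (g x - g o) • ξ - (g y - g o) • ξ = ((g x - g o) - (g y - g o)) • ξ :=
      (sub_smul _ _ _).symm
    rw [dist_eq_norm, e, norm_smul, sub_sub_sub_cancel_right, ← dist_eq_norm]
    exact (mul_le_of_le_one_right dist_nonneg hξ).trans h
  refine ⟨⟨fun m => (g m - g o) • ξ, by simp, 1, hG⟩, ?_, fun m => rfl⟩
  refine Lip.norm_le_of_forall _ zero_le_one fun x y => ?_
  simpa [dist_eq_norm] using hG.dist_le_mul x y

/-! ### The strong diameter two property -/

theorem dist_convex_combination_le_two {E : Type*} [NormedAddCommGroup E] [NormedSpace ℝ E] {n : ℕ}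
    {c : Fin n → ℝ} (hc : ∀ i, 0 < c i) (hsum : ∑ i, c i = 1) {x y : Fin n → E}
    (hx : ∀ i, ‖x i‖ ≤ 1) (hy : ∀ i, ‖y i‖ ≤ 1) :
    dist (∑ i, c i • x i) (∑ i, c i • y i) ≤ 2 := by
  rw [dist_eq_norm, ← Finset.sum_sub_distrib]
  calc ‖∑ i, (c i • x i - c i • y i)‖ ≤ ∑ i, c i * 2 := by
        refine norm_sum_le_of_le _ fun i _ => ?_
        rw [← smul_sub, norm_smul, Real.norm_of_nonneg (hc i).le]
        exact mul_le_mul_of_nonneg_left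
          ((norm_sub_le _ _).trans (by linarith [hx i, hy i])) (hc i).le
    _ = 2 := by rw [← Finset.sum_mul, hsum, one_mul]

/-- To prove the strong diameter two property it suffices to find, for slices `S(B_E, f i, α i)`
with `α i ≤ 1` and `ε > 0`, two points of their convex combination at distance above `2 - ε`. -/
theorem StrongDiameterTwoProperty.of_exists {E : Type*} [NormedAddCommGroup E] [NormedSpace ℝ E]
    (H : ∀ (n : ℕ) (f : Fin n → StrongDual ℝ E) (α c : Fin n → ℝ),
      (∀ i, ‖f i‖ = 1) → (∀ i, 0 < α i) → (∀ i, α i ≤ 1) → (∀ i, 0 < c i) → ∑ i, c i = 1 →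
      ∀ ε > 0, ∃ u v : Fin n → E, (∀ i, u i ∈ ballSlice (f i) (α i)) ∧
        (∀ i, v i ∈ ballSlice (f i) (α i)) ∧
        2 - ε < dist (∑ i, c i • u i) (∑ i, c i • v i)) :
    StrongDiameterTwoProperty E := by
  intro n f α c hf hα hc hsum
  have hle : ∀ a ∈ {z : E | ∃ x : Fin n → E, (∀ i, x i ∈ ballSlice (f i) (α i)) ∧
      z = ∑ i, c i • x i}, ∀ b ∈ {z : E | ∃ x : Fin n → E, (∀ i, x i ∈ ballSlice (f i) (α i)) ∧
      z = ∑ i, c i • x i}, dist a b ≤ 2 := by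
    rintro a ⟨x, hx, rfl⟩ b ⟨y, hy, rfl⟩
    exact dist_convex_combination_le_two hc hsum (fun i => (hx i).1) (fun i => (hy i).1)
  refine le_antisymm (Metric.diam_le_of_forall_dist_le zero_le_two hle)
    (le_of_forall_pos_lt_add fun ε hε => ?_)
  obtain ⟨u, v, hu, hv, huv⟩ := H n f (fun i => min (α i) 1) c hf
    (fun i => lt_min (hα i) one_pos) (fun i => min_le_right _ _) hc hsum ε hε
  have hmono : ∀ i, ballSlice (f i) (min (α i) 1) ⊆ ballSlice (f i) (α i) := fun i z hz =>
    ⟨hz.1, lt_of_le_of_lt (by linarith [min_le_left (α i) 1]) hz.2⟩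
  have := Metric.dist_le_diam_of_mem (Metric.isBounded_iff.2 ⟨2, fun a ha b hb => hle a ha b hb⟩)
    ⟨u, fun i => hmono i (hu i), rfl⟩ ⟨v, fun i => hmono i (hv i), rfl⟩
  linarith

/-- In a space with the strong diameter two property, `∑ i, c i • x i` and `∑ i, c i • y i` can be
kept almost two apart, as a functional `ξ` witnesses, while the `x i` and `y i` in the unit ball are
to satisfy `t i < ψ i (x i)`, `t i < ψ i (y i)` for given `t i < ‖ψ i‖`. -/
theorem StrongDiameterTwoProperty.exists_separated {X : Type*} [NormedAddCommGroup X]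
    [NormedSpace ℝ X] (hX : StrongDiameterTwoProperty X) {n : ℕ} {ψ : Fin n → StrongDual ℝ X}
    {t c : Fin n → ℝ} (ht0 : ∀ i, 0 ≤ t i) (ht : ∀ i, t i < ‖ψ i‖) (hc : ∀ i, 0 < c i)
    (hsum : ∑ i, c i = 1) {ε : ℝ} (hε : 0 < ε) :
    ∃ (x y : Fin n → X) (ξ : StrongDual ℝ X), ‖ξ‖ ≤ 1 ∧
      (∀ i, ‖x i‖ ≤ 1 ∧ t i < ψ i (x i)) ∧ (∀ i, ‖y i‖ ≤ 1 ∧ t i < ψ i (y i)) ∧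
      2 - ε < ∑ i, c i * (ξ (x i) - ξ (y i)) := by
  have hpos : ∀ i, 0 < ‖ψ i‖ := fun i => (ht0 i).trans_lt (ht i)
  have hslice : ∀ i z, z ∈ ballSlice (‖ψ i‖⁻¹ • ψ i) (1 - t i / ‖ψ i‖) →
      ‖z‖ ≤ 1 ∧ t i < ψ i z := by
    rintro i z ⟨hz, h⟩
    refine ⟨hz, ?_⟩
    rw [sub_sub_cancel, smul_apply, smul_eq_mul, ← div_eq_inv_mul] at h
    exact (div_lt_div_iff_of_pos_right (hpos i)).1 h
  have hdiam := hX n (fun i => ‖ψ i‖⁻¹ • ψ i) (fun i => 1 - t i / ‖ψ i‖) c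
    (fun i => by rw [norm_smul, norm_inv, norm_norm, inv_mul_cancel₀ (hpos i).ne'])
    (fun i => sub_pos.2 ((div_lt_one (hpos i)).2 (ht i))) hc hsum
  obtain ⟨x, y, hx, hy, hxy⟩ : ∃ x y : Fin n → X,
      (∀ i, x i ∈ ballSlice (‖ψ i‖⁻¹ • ψ i) (1 - t i / ‖ψ i‖)) ∧
      (∀ i, y i ∈ ballSlice (‖ψ i‖⁻¹ • ψ i) (1 - t i / ‖ψ i‖)) ∧
      2 - ε < dist (∑ i, c i • x i) (∑ i, c i • y i) := by
    by_contra! H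
    have := Metric.diam_le_of_forall_dist_le (le_max_right (2 - ε) 0) (s := {z : X |
      ∃ x : Fin n → X, (∀ i, x i ∈ ballSlice (‖ψ i‖⁻¹ • ψ i) (1 - t i / ‖ψ i‖)) ∧
        z = ∑ i, c i • x i}) (by
        rintro a ⟨x, hx, rfl⟩ b ⟨y, hy, rfl⟩
        exact (H x y hx hy).trans (le_max_left _ _))
    rw [hdiam] at this
    rcases le_max_iff.1 this with h | h <;> linarith
  obtain ⟨ξ, hξ, hξxy⟩ := exists_dual_vector'' ℝ (∑ i, c i • x i - ∑ i, c i • y i)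
  refine ⟨x, y, ξ, hξ, fun i => hslice i _ (hx i), fun i => hslice i _ (hy i), ?_⟩
  rw [dist_eq_norm] at hxy
  have e : ξ (∑ i, c i • x i - ∑ i, c i • y i) = ∑ i, c i * (ξ (x i) - ξ (y i)) := by
    simp only [map_sub, map_sum, map_smul, smul_eq_mul, mul_sub, Finset.sum_sub_distrib]
  rw [← e, hξxy]
  exact hxy

theorem proposition3 {M : Type*} [MetricSpace M] (o : M) {X : Type*} [NormedAddCommGroup X]
    [NormedSpace ℝ X] [CompleteSpace X] (hM : MetricallyConvex M)
    (hX : StrongDiameterTwoProperty X) :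
    StrongDiameterTwoProperty (lipFree o X) := by
  change StrongDiameterTwoProperty (LipFreeSpace o X)
  refine StrongDiameterTwoProperty.of_exists fun n f α c hf hα hα1 hc hsum ε hε => ?_
  choose h hrep hsteep using fun i => LipFreeSpace.exists_lip_representing_steep (hf i)
  have hα0 : ∀ i, 0 ≤ 1 - α i := fun i => sub_nonneg.2 (hα1 i)
  choose p₀ q₀ hne₀ hst₀ using fun i => hsteep i (1 - α i) (hα0 i) (by linarith [hα i])
  obtain ⟨x, y, ξ, hξ, hx, hy, hxy⟩ := hX.exists_separated
    (fun i => mul_nonneg (hα0 i) dist_nonneg) hst₀ hc hsum (ε := ε / 3) (by positivity)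
  -- `z (i, true)` and `z (i, false)` are the vectors of the two points under construction.
  let z : Fin n × Bool → X := fun j => if j.2 then x j.1 else y j.1
  have hz : ∀ j, ‖z j‖ ≤ 1 ∧
      (1 - α j.1) * dist (p₀ j.1) (q₀ j.1) < (h j.1 (p₀ j.1) - h j.1 (q₀ j.1)) (z j) := by
    rintro ⟨i, b⟩
    cases b
    · exact hy i
    · exact hx i
  obtain ⟨κ, hκ1, hκ⟩ : ∃ κ : ℝ≥0, κ < 1 ∧ 1 - ε / 3 ≤ κ := by
    refine ⟨(1 - ε / 3).toNNReal, ?_, Real.le_coe_toNNReal _⟩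
    rw [Real.toNNReal_lt_one]
    linarith
  obtain ⟨p, q, g, hg, hpq⟩ := exists_lipschitz_steep_on_pairs
    (fun (j : Fin n × Bool) a b => (1 - α j.1) * dist a b < h j.1 a (z j) - h j.1 b (z j))
    (fun j ρ hρ => hM.exists_steep_pair_dist_lt (fun m => h j.1 m (z j)) (hne₀ j.1) (hz j).2 hρ)
    hκ1
  let μ : Fin n × Bool → LipFreeSpace o X := fun j => LipFreeSpace.molecule o (p j) (q j) (z j)
  have hμ : ∀ j f, LipFreeSpace.toDual (μ j) f =
      (dist (p j) (q j))⁻¹ * (f (p j) (z j) - f (q j) (z j)) :=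
    fun j f => LipFreeSpace.toDual_molecule_apply (p j) (q j) (z j) f
  have hmem : ∀ j, μ j ∈ ballSlice (f j.1) (α j.1) := by
    intro j
    refine ⟨(LipFreeSpace.norm_molecule_le _ _ _).trans (hz j).1, ?_⟩
    rw [hrep, hμ, ← div_eq_inv_mul, lt_div_iff₀ (dist_pos.2 (hpq j).1)]
    exact (hpq j).2.1
  refine ⟨fun i => μ (i, true), fun i => μ (i, false), fun i => hmem (i, true),
    fun i => hmem (i, false), ?_⟩
  obtain ⟨G, hG, hGapp⟩ := exists_lip_tensor (o := o) hg hξ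
  -- The slope of `g` on the pair `j` lies in `[1 - ε / 3, 1]`, so that the tensor takes nearly the
  -- value `ξ (z j)` at the molecule `j`.
  have hval : ∀ j, |LipFreeSpace.toDual (μ j) G - ξ (z j)| ≤ ε / 3 := by
    intro j
    have hd : 0 < dist (p j) (q j) := dist_pos.2 (hpq j).1
    set s : ℝ := (dist (p j) (q j))⁻¹ * (g (p j) - g (q j)) with hs
    have hs1 : s ≤ 1 := by
      rw [hs, inv_mul_le_iff₀ hd, mul_one]
      have := hg.dist_le_mul (p j) (q j)
      rw [Real.dist_eq, NNReal.coe_one, one_mul] at this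
      exact (le_abs_self _).trans this
    have hs2 : 1 - ε / 3 ≤ s := by
      refine hκ.trans ?_
      rw [hs, ← div_eq_inv_mul, le_div_iff₀ hd]
      exact (hpq j).2.2
    have e : LipFreeSpace.toDual (μ j) G - ξ (z j) = (s - 1) * ξ (z j) := by
      rw [hμ, hGapp, hGapp, hs]
      simp only [smul_apply, smul_eq_mul]
      ring
    have hξz : |ξ (z j)| ≤ 1 := ξ.unit_le_opNorm _ (hz j).1 |>.trans hξ
    rw [e, abs_mul, abs_of_nonpos (by linarith)]
    exact (mul_le_of_le_one_right (by linarith) hξz).trans (by linarith)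
  rw [dist_eq_norm, ← Finset.sum_sub_distrib]
  set D : LipFreeSpace o X := ∑ i, (c i • μ (i, true) - c i • μ (i, false)) with hD
  have hDG : LipFreeSpace.toDual D G ≤ ‖D‖ := by
    rw [← LipFreeSpace.toDual.norm_map D]
    exact (le_abs_self _).trans ((LipFreeSpace.toDual D).unit_le_opNorm G hG)
  have hDsum : LipFreeSpace.toDual D G = ∑ i, c i *
      (LipFreeSpace.toDual (μ (i, true)) G - LipFreeSpace.toDual (μ (i, false)) G) := by
    simp [hD, mul_sub, -Finset.sum_sub_distrib]
  have hlow : ∑ i, c i * (ξ (x i) - ξ (y i)) - 2 * (ε / 3) ≤ LipFreeSpace.toDual D G := by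
    rw [hDsum, sub_le_iff_le_add]
    calc ∑ i, c i * (ξ (x i) - ξ (y i))
        ≤ ∑ i, (c i * (LipFreeSpace.toDual (μ (i, true)) G -
            LipFreeSpace.toDual (μ (i, false)) G) + c i * (2 * (ε / 3))) := by
          refine Finset.sum_le_sum fun i _ => ?_
          rw [← mul_add]
          refine mul_le_mul_of_nonneg_left ?_ (hc i).le
          have h1 := (abs_le.1 (hval (i, true))).1
          have h2 := (abs_le.1 (hval (i, false))).2
          simp only [z, if_true, Bool.false_eq_true, if_false] at h1 h2
          linarith
      _ = _ := by rw [Finset.sum_add_distrib, ← Finset.sum_mul, hsum, one_mul]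
  linarith
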